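/- For $m\in\mathbb N=\{0,1,2,\dots\}$ let $P_m$ be the complex vector space of homogeneous polynomials of degree $m$ in $x_1,x_2$, with the inner product (conjugate linear in the first variable) given by $\langle x_1^{l}x_2^{m-l},x_1^{k}x_2^{m-k}\rangle=l!\,(m-l)!\,\delta_{lk}$. Identify $P_m\otimes P_n$ (with the tensor product inner product) with the space of polynomials of bidegree $(m,n)$ in $x=(x_1,x_2)$, $y=(y_1,y_2)$ via $f\otimes g\mapsto f(x)g(y)$, and put $$\Delta_{yx}=y_1\frac{\partial}{\partial x_1}+y_2\frac{\partial}{\partial x_2},\qquad \Gamma_{xy}f=(x_1y_2-y_1x_2)f .$$ For $0\le h\le\min\{m,n\}$ define $c_{m,n,h}$ recursively by $c_{m,0,0}=1$ and, for $n\ge1$, $$c_{m,n,h}=\frac1{(m+1)n}\begin{cases}c_{m+1,n-1,0}&h=0,\\ c_{m-1,n-1,h-1}+c_{m+1,n-1,h}&0<h<n,\\ c_{m-1,n-1,h-1}&h=n.\end{cases}$$ Let $r=m+n-2h$, let $\alpha_{m,n,h}:P_r\to P_m\otimes P_n$ be given by $\alpha_{m,n,h}(f)=\sqrt{c_{m,n,h}}\;\Gamma_{xy}^{h}\Delta_{yx}^{n-h}f(x)$,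 and let $\Phi_{m,n,h}:\mathrm{End}(P_r)\to\mathrm{End}(P_m)$ be $$\Phi_{m,n,h}(A)=\mathrm{Tr}_{P_n}\bigl(\alpha_{m,n,h}\,A\,\alpha_{m,n,h}^{*}\bigr),$$ where $\mathrm{Tr}_{P_n}$ is the partial trace over the second factor. For finite-dimensional Hilbert spaces $H,K$, the dual map of a linear map $\Phi:\mathrm{End}(H)\to\mathrm{End}(K)$ is the unique linear map $\Phi^{*}:\mathrm{End}(K)\to\mathrm{End}(H)$ with $\mathrm{tr}(B^{*}\Phi(A))=\mathrm{tr}(\Phi^{*}(B)^{*}A)$ for all $A\in\mathrm{End}(H)$, $B\in\mathrm{End}(K)$; a channel is a completely positive, trace preserving linear map. **Corollary 5.6.** Let $m,n,h\in\mathbb N$ with $0\le h\le\min\{m,n\}$ and $r=m+n-2h$. Then $$\Phi_{m,n,h}^{*}=\frac{r+1}{m+1}\,\Phi_{r,n,n-h}.$$ Moreover, $\Phi_{m,n,h}^{*}$ is a channel if and only if $n=2h$, and in that case (where $r=m$) $\Phi_{m,2h,h}^{*}=\Phi_{m,2h,h}$. -/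

import Mathlib

open scoped TensorProduct

namespace Eposic

noncomputable section

open MvPolynomial

/-! ### The spaces `P_m` of binary forms and their inner products -/

/-- `P m` is the complex vector space of homogeneous polynomials of degree `m` in the two
variables `x₁ = X 0`, `x₂ = X 1`. -/
abbrev P (m : ℕ) : Type := homogeneousSubmodule (Fin 2) ℂ m

/-- The exponent vector of the monomial `x₁ ^ a * x₂ ^ b`. -/
def expo (a b : ℕ) : Fin 2 →₀ ℕ := Finsupp.single 0 a + Finsupp.single 1 b

lemma expo_zero (a b : ℕ) : expo a b 0 = a := by simp [expo]

lemma expo_one (a b : ℕ) : expo a b 1 = b := by simp [expo]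

lemma eq_expo (d : Fin 2 →₀ ℕ) : d = expo (d 0) (d 1) := by
  ext i
  fin_cases i <;> simp [expo]

lemma expo_degree (a b : ℕ) : (expo a b).degree = a + b := by
  simp [Finsupp.degree_eq_sum, expo_zero, expo_one]

instance (m : ℕ) : FiniteDimensional ℂ (P m) :=
  Module.Finite.iff_fg.mpr (homogeneousSubmodule_fg _ _ m)

/-- The coefficient of `x₁ ^ l * x₂ ^ (m - l)` in `f`. -/
def cf {m : ℕ} (l : ℕ) (f : P m) : ℂ := coeff (expo l (m - l)) (f : MvPolynomial (Fin 2) ℂ)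

lemma cf_ext {m : ℕ} (f : P m) (h : ∀ l ∈ Finset.range (m + 1), cf l f = 0) : f = 0 := by
  apply Subtype.ext
  ext d
  by_cases hd : d.degree = m
  · have h2 : d 0 + d 1 = m := by
      rw [← hd, eq_expo d, expo_degree, expo_zero, expo_one]
    have h3 := h (d 0) (by simp; omega)
    have h4 : m - d 0 = d 1 := by omega
    rw [cf, h4, ← eq_expo] at h3
    simpa using h3
  · have := (mem_homogeneousSubmodule m _).1 f.2
    simpa using this.coeff_eq_zero hd

/-- The inner product on `P m` for which the monomials `x₁ ^ l * x₂ ^ (m - l)` are pairwise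
orthogonal, with squared norms `l! * (m - l)!`. It is conjugate linear in the first variable. -/
@[reducible] def innerCore (m : ℕ) : InnerProductSpace.Core ℂ (P m) where
  inner f g := ∑ l ∈ Finset.range (m + 1),
    ((l.factorial * (m - l).factorial : ℕ) : ℂ) * (starRingEnd ℂ (cf l f) * cf l g)
  conj_inner_symm f g := by
    simp only [map_sum, map_mul, Complex.conj_conj, map_natCast]
    exact Finset.sum_congr rfl fun _ _ => by ring
  re_inner_nonneg f := by
    simp only [map_sum]
    refine Finset.sum_nonneg fun l _ => ?_
    rw [Complex.conj_mul', ← Complex.ofReal_natCast, ← Complex.ofReal_pow, ← Complex.ofReal_mul]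
    simp only [RCLike.re_to_complex, Complex.ofReal_re]
    positivity
  add_left f g k := by
    rw [← Finset.sum_add_distrib]
    refine Finset.sum_congr rfl fun l _ => ?_
    simp only [cf, Submodule.coe_add, coeff_add, map_add]
    ring
  smul_left f g c := by
    rw [Finset.mul_sum]
    refine Finset.sum_congr rfl fun l _ => ?_
    simp only [cf, Submodule.coe_smul, coeff_smul, smul_eq_mul, map_mul]
    ring
  definite f h := by
    have h1 : (∑ l ∈ Finset.range (m + 1),
        ((l.factorial * (m - l).factorial : ℕ) : ℝ) * ‖cf l f‖ ^ 2) = 0 := by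
      have h2 : (∑ l ∈ Finset.range (m + 1), ((l.factorial * (m - l).factorial : ℕ) : ℂ) *
        (starRingEnd ℂ (cf l f) * cf l f)) = 0 := h
      simp only [Complex.conj_mul'] at h2
      exact_mod_cast h2
    rw [Finset.sum_eq_zero_iff_of_nonneg (fun l _ => by positivity)] at h1
    refine cf_ext f fun l hl => ?_
    have h3 := h1 l hl
    have h4 : ((l.factorial * (m - l).factorial : ℕ) : ℝ) ≠ 0 := by positivity
    simpa [h4] using (mul_eq_zero.1 h3).resolve_left h4

instance (m : ℕ) : NormedAddCommGroup (P m) := (innerCore m).toNormedAddCommGroup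

instance (m : ℕ) : InnerProductSpace ℂ (P m) := InnerProductSpace.ofCore (innerCore m).toCore

lemma inner_P {m : ℕ} (f g : P m) : inner ℂ f g = ∑ l ∈ Finset.range (m + 1),
    ((l.factorial * (m - l).factorial : ℕ) : ℂ) * (starRingEnd ℂ (cf l f) * cf l g) := rfl

/-! ### `P_m ⊗ P_n` as the space of polynomials of bidegree `(m, n)` -/

/-- Polynomials in `x = (x₁, x₂)` (the `Sum.inl` variables) and `y = (y₁, y₂)` (the `Sum.inr`
variables). -/
abbrev Pxy : Type := MvPolynomial (Fin 2 ⊕ Fin 2) ℂ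

/-- The weight that records the bidegree. -/
def bideg : Fin 2 ⊕ Fin 2 → ℕ × ℕ := Sum.elim (fun _ => (1, 0)) (fun _ => (0, 1))

/-- Polynomials that are homogeneous of degree `m` in `x` and of degree `n` in `y`. -/
abbrev BiP (m n : ℕ) : Submodule ℂ Pxy := weightedHomogeneousSubmodule ℂ bideg (m, n)

lemma rename_inl_mem {m : ℕ} (f : P m) :
    IsWeightedHomogeneous bideg (rename Sum.inl (f : MvPolynomial (Fin 2) ℂ) : Pxy) (m, 0) := by
  have hf : (f : MvPolynomial (Fin 2) ℂ).IsHomogeneous m := f.2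
  intro d hd
  obtain ⟨u, rfl, hu⟩ := coeff_rename_ne_zero _ _ _ hd
  have h1 := hf hu
  rw [eq_expo u] at h1 ⊢
  simp only [expo, Finsupp.mapDomain_add, Finsupp.mapDomain_single, map_add,
    Finsupp.weight_single] at h1 ⊢
  simpa [bideg] using h1

lemma rename_inr_mem {n : ℕ} (f : P n) :
    IsWeightedHomogeneous bideg (rename Sum.inr (f : MvPolynomial (Fin 2) ℂ) : Pxy) (0, n) := by
  have hf : (f : MvPolynomial (Fin 2) ℂ).IsHomogeneous n := f.2
  intro d hd
  obtain ⟨u, rfl, hu⟩ := coeff_rename_ne_zero _ _ _ hd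
  have h1 := hf hu
  rw [eq_expo u] at h1 ⊢
  simp only [expo, Finsupp.mapDomain_add, Finsupp.mapDomain_single, map_add,
    Finsupp.weight_single] at h1 ⊢
  simpa [bideg] using h1

/-- The linear map `P_m(x) ⊗ P_n(y) → ℂ[x, y]` with `f ⊗ g ↦ f(x) g(y)`. -/
def tensorToPxy (m n : ℕ) : P m ⊗[ℂ] P n →ₗ[ℂ] Pxy :=
  TensorProduct.lift
    ((LinearMap.mul ℂ Pxy).compl₁₂
      ((rename Sum.inl).toLinearMap ∘ₗ (homogeneousSubmodule (Fin 2) ℂ m).subtype)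
      ((rename Sum.inr).toLinearMap ∘ₗ (homogeneousSubmodule (Fin 2) ℂ n).subtype))

lemma tensorToPxy_tmul {m n : ℕ} (f : P m) (g : P n) :
    tensorToPxy m n (f ⊗ₜ g) =
      rename Sum.inl (f : MvPolynomial (Fin 2) ℂ) * rename Sum.inr (g : MvPolynomial (Fin 2) ℂ) :=
  rfl

lemma tensorToPxy_mem {m n : ℕ} (t : P m ⊗[ℂ] P n) : tensorToPxy m n t ∈ BiP m n := by
  induction t with
  | zero => simp
  | add a b ha hb => rw [map_add]; exact Submodule.add_mem _ ha hb
  | tmul f g =>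
    have := (rename_inl_mem f).mul (rename_inr_mem g)
    rw [tensorToPxy_tmul]
    simpa using this

/-- The monomial `x₁ ^ l * x₂ ^ (m - l)` of degree `m`. -/
def mono (m : ℕ) (l : Fin (m + 1)) : P m :=
  ⟨monomial (expo l (m - l)) 1, isHomogeneous_monomial _ (by rw [expo_degree]; omega)⟩

lemma sum_mono {m : ℕ} (f : P m) : f = ∑ l : Fin (m + 1), cf l f • mono m l := by
  rw [← sub_eq_zero]
  refine cf_ext _ fun k hk => ?_
  have hk' : k < m + 1 := by simpa using hk
  have hcf : ∀ l : Fin (m + 1), cf k (mono m l) = if (⟨k, hk'⟩ : Fin (m + 1)) = l then 1 else 0 := by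
    intro l
    rw [cf, mono, coeff_monomial]
    congr 1
    apply propext
    constructor
    · intro h
      have := DFunLike.congr_fun h 0
      rw [expo_zero, expo_zero] at this
      exact Fin.ext this.symm
    · rintro rfl; rfl
  let L : P m →ₗ[ℂ] ℂ := lcoeff ℂ (expo k (m - k)) ∘ₗ Submodule.subtype _
  have hL : ∀ g : P m, cf k g = L g := fun g => rfl
  rw [hL, map_sub, map_sum]
  simp only [map_smul]
  simp only [← hL, hcf]
  simp

/-- The exponent vector of `x₁ ^ a * x₂ ^ b * y₁ ^ c * y₂ ^ d`. -/
def expo4 (a b c d : ℕ) : (Fin 2 ⊕ Fin 2) →₀ ℕ :=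
  (expo a b).mapDomain Sum.inl + (expo c d).mapDomain Sum.inr

lemma tensorToPxy_mono {m n : ℕ} (s : Fin (m + 1)) (t : Fin (n + 1)) :
    tensorToPxy m n (mono m s ⊗ₜ mono n t) = monomial (expo4 s (m - s) t (n - t)) 1 := by
  rw [tensorToPxy_tmul, mono, mono, rename_monomial, rename_monomial, monomial_mul, one_mul, expo4]

lemma expo4_inl (a b c d : ℕ) : expo4 a b c d (Sum.inl 0) = a := by
  simp [expo4, expo, Finsupp.mapDomain_add]

lemma expo4_inr (a b c d : ℕ) : expo4 a b c d (Sum.inr 0) = c := by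
  simp [expo4, expo, Finsupp.mapDomain_add]

lemma eq_expo4 (e : (Fin 2 ⊕ Fin 2) →₀ ℕ) :
    e = expo4 (e (Sum.inl 0)) (e (Sum.inl 1)) (e (Sum.inr 0)) (e (Sum.inr 1)) := by
  ext i
  rcases i with i | i <;> fin_cases i <;> simp [expo4, expo, Finsupp.mapDomain_add]

lemma weight_expo4 (a b c d : ℕ) :
    Finsupp.weight bideg (expo4 a b c d) = (a + b, c + d) := by
  simp [expo4, expo, Finsupp.mapDomain_add, Finsupp.weight_single, bideg]

lemma tensorToPxy_injective (m n : ℕ) : Function.Injective (tensorToPxy m n) := by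
  let inv : Pxy →ₗ[ℂ] P m ⊗[ℂ] P n := ∑ s : Fin (m + 1), ∑ t : Fin (n + 1),
    (lcoeff ℂ (expo4 s (m - s) t (n - t))).smulRight (mono m s ⊗ₜ[ℂ] mono n t)
  have hinv : ∀ s t, inv (tensorToPxy m n (mono m s ⊗ₜ mono n t)) = mono m s ⊗ₜ mono n t := by
    intro s t
    have key : ∀ (s' : Fin (m + 1)) (t' : Fin (n + 1)),
        expo4 s (m - s) t (n - t) = expo4 s' (m - s') t' (n - t') ↔ s = s' ∧ t = t' := by
      intro s' t'
      constructor
      · intro h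
        have h1 := DFunLike.congr_fun h (Sum.inl 0)
        have h2 := DFunLike.congr_fun h (Sum.inr 0)
        rw [expo4_inl, expo4_inl] at h1
        rw [expo4_inr, expo4_inr] at h2
        exact ⟨Fin.ext h1, Fin.ext h2⟩
      · rintro ⟨rfl, rfl⟩; rfl
    simp only [inv, LinearMap.sum_apply, LinearMap.smulRight_apply, tensorToPxy_mono, lcoeff_apply,
      coeff_monomial, key]
    rw [Finset.sum_eq_single s, Finset.sum_eq_single t]
    · simp
    · intro t' _ h; simp [h.symm]
    · simp
    · intro s' _ h; simp [h.symm]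
    · simp
  have hid : inv ∘ₗ tensorToPxy m n = LinearMap.id := by
    refine TensorProduct.ext' fun f g => ?_
    rw [sum_mono f, sum_mono g]
    simp only [TensorProduct.sum_tmul, TensorProduct.tmul_sum, ← TensorProduct.smul_tmul',
      TensorProduct.tmul_smul, map_sum, map_smul, LinearMap.comp_apply, hinv, LinearMap.id_apply]
  exact Function.LeftInverse.injective (g := inv) (fun t => DFunLike.congr_fun hid t)

lemma tensorToPxy_surjective {m n : ℕ} (F : Pxy) (hF : F ∈ BiP m n) :
    ∃ t, tensorToPxy m n t = F := by
  change F ∈ LinearMap.range (tensorToPxy m n)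
  rw [F.as_sum]
  refine Submodule.sum_mem _ fun e he => ?_
  have h1 := hF (mem_support_iff.1 he)
  rw [eq_expo4 e, weight_expo4, Prod.mk.injEq] at h1
  refine ⟨coeff e F • (mono m ⟨e (Sum.inl 0), by omega⟩ ⊗ₜ mono n ⟨e (Sum.inr 0), by omega⟩), ?_⟩
  rw [map_smul, tensorToPxy_mono, smul_monomial, smul_eq_mul, mul_one]
  have h2 : m - e (Sum.inl 0) = e (Sum.inl 1) := by omega
  have h3 : n - e (Sum.inr 0) = e (Sum.inr 1) := by omega
  simp only [h2, h3]
  rw [← eq_expo4 e]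

/-- The identification of `P_m(x) ⊗ P_n(y)` with the polynomials of bidegree `(m, n)`. -/
def tensorEquiv (m n : ℕ) : P m ⊗[ℂ] P n ≃ₗ[ℂ] BiP m n :=
  LinearEquiv.ofBijective ((tensorToPxy m n).codRestrict (BiP m n) tensorToPxy_mem)
    ⟨fun a b h => tensorToPxy_injective m n (congrArg Subtype.val h),
     fun F => (tensorToPxy_surjective F.1 F.2).imp fun _ h => Subtype.ext h⟩

/-! ### The isometries `α_{m,n,h}` -/

/-- `Δ_{yx} = y₁ ∂/∂x₁ + y₂ ∂/∂x₂`. -/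
def deltaYX : Pxy →ₗ[ℂ] Pxy :=
  LinearMap.mulLeft ℂ (X (Sum.inr 0)) ∘ₗ (pderiv (Sum.inl 0)).toLinearMap +
    LinearMap.mulLeft ℂ (X (Sum.inr 1)) ∘ₗ (pderiv (Sum.inl 1)).toLinearMap

/-- `Γ_{xy}`, multiplication by `x₁ y₂ - y₁ x₂`. -/
def gammaXY : Pxy →ₗ[ℂ] Pxy :=
  LinearMap.mulLeft ℂ
    (X (Sum.inl 0) * X (Sum.inr 1) - X (Sum.inr 0) * X (Sum.inl 1))

lemma deltaYX_mem {a b : ℕ} {F : Pxy} (hF : F ∈ BiP (a + 1) b) : deltaYX F ∈ BiP a (b + 1) := by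
  have hF' : IsWeightedHomogeneous bideg F (a + 1, b) := hF
  have h (i : Fin 2) :
      IsWeightedHomogeneous bideg (X (Sum.inr i) * pderiv (Sum.inl i) F) (a, b + 1) := by
    have h1 : IsWeightedHomogeneous bideg (pderiv (Sum.inl i) F) (a, b) :=
      hF'.pderiv (by simp [bideg])
    have h2 := (isWeightedHomogeneous_X ℂ bideg (Sum.inr i)).mul h1
    simpa [bideg, add_comm] using h2
  exact (h 0).add (h 1)

lemma gammaXY_mem {a b : ℕ} {F : Pxy} (hF : F ∈ BiP a b) :
    gammaXY F ∈ BiP (a + 1) (b + 1) := by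
  have hF' : IsWeightedHomogeneous bideg F (a, b) := hF
  have h1 : IsWeightedHomogeneous bideg
      (X (Sum.inl 0) * X (Sum.inr 1) - X (Sum.inr 0) * X (Sum.inl 1) : Pxy) (1, 1) := by
    apply IsWeightedHomogeneous.sub
    · simpa [bideg] using
        (isWeightedHomogeneous_X ℂ bideg (Sum.inl 0)).mul
          (isWeightedHomogeneous_X ℂ bideg (Sum.inr 1))
    · simpa [bideg] using
        (isWeightedHomogeneous_X ℂ bideg (Sum.inr 0)).mul
          (isWeightedHomogeneous_X ℂ bideg (Sum.inl 1))
  have h2 := h1.mul hF'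
  simpa [gammaXY, add_comm] using h2

lemma deltaYX_pow_mem (k : ℕ) {a b : ℕ} {F : Pxy} (hF : F ∈ BiP (a + k) b) :
    (deltaYX ^ k) F ∈ BiP a (b + k) := by
  induction k generalizing b F with
  | zero => simpa using hF
  | succ k ih =>
    rw [pow_succ, Module.End.mul_apply]
    have := ih (b := b + 1) (deltaYX_mem (a := a + k) hF)
    rwa [show b + (k + 1) = b + 1 + k by omega]

lemma gammaXY_pow_mem (k : ℕ) {a b : ℕ} {F : Pxy} (hF : F ∈ BiP a b) :
    (gammaXY ^ k) F ∈ BiP (a + k) (b + k) := by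
  induction k with
  | zero => simpa using hF
  | succ k ih =>
    rw [pow_succ', Module.End.mul_apply]
    exact gammaXY_mem ih

/-- The coefficients `c_{m,n,h}`, for `h ≤ min m n`, defined by recursion on `n`.
Values outside this range are irrelevant. -/
def cgCoeff : ℕ → ℕ → ℕ → ℝ
  | _, 0, _ => 1
  | m, n + 1, 0 => 1 / (((m : ℝ) + 1) * ((n : ℝ) + 1)) * cgCoeff (m + 1) n 0
  | m, n + 1, h + 1 =>
    if h + 1 < n + 1 then
      1 / (((m : ℝ) + 1) * ((n : ℝ) + 1)) * (cgCoeff (m - 1) n h + cgCoeff (m + 1) n (h + 1))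
    else
      1 / (((m : ℝ) + 1) * ((n : ℝ) + 1)) * cgCoeff (m - 1) n h

/-- The polynomial map `f(x) ↦ √c_{m,n,h} Γ_{xy}^h Δ_{yx}^{n-h} f(x)`. -/
def alphaPoly (m n h : ℕ) {r : ℕ} : P r →ₗ[ℂ] Pxy :=
  ((Real.sqrt (cgCoeff m n h) : ℝ) : ℂ) • ((gammaXY ^ h) ∘ₗ (deltaYX ^ (n - h)) ∘ₗ
    (rename Sum.inl).toLinearMap ∘ₗ (homogeneousSubmodule (Fin 2) ℂ r).subtype)

lemma alphaPoly_mem {m n h r : ℕ} (hh : h ≤ min m n) (hr : r = m + n - 2 * h) (f : P r) :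
    alphaPoly m n h f ∈ BiP m n := by
  have hm : h ≤ m := le_trans hh (min_le_left _ _)
  have hn : h ≤ n := le_trans hh (min_le_right _ _)
  refine Submodule.smul_mem _ _ ?_
  have h1 : (rename Sum.inl (f : MvPolynomial (Fin 2) ℂ) : Pxy) ∈ BiP ((m - h) + (n - h)) 0 := by
    rw [show (m - h) + (n - h) = r by omega]
    exact rename_inl_mem f
  have h2 := gammaXY_pow_mem h (deltaYX_pow_mem (n - h) h1)
  rwa [show m - h + h = m by omega, show 0 + (n - h) + h = n by omega] at h2

/-- `α_{m,n,h} : P_r → P_m ⊗ P_n`, where `r = m + n - 2h`. -/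
def alpha (m n h r : ℕ) (hh : h ≤ min m n) (hr : r = m + n - 2 * h) :
    P r →ₗ[ℂ] P m ⊗[ℂ] P n :=
  (tensorEquiv m n).symm.toLinearMap ∘ₗ (alphaPoly m n h).codRestrict (BiP m n) (alphaPoly_mem hh hr)

lemma tensorToPxy_alpha (m n h r : ℕ) (hh : h ≤ min m n) (hr : r = m + n - 2 * h) (f : P r) :
    tensorToPxy m n (alpha m n h r hh hr f) =
      ((Real.sqrt (cgCoeff m n h) : ℝ) : ℂ) •
        (gammaXY ^ h) ((deltaYX ^ (n - h)) (rename Sum.inl (f : MvPolynomial (Fin 2) ℂ))) :=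
  congrArg Subtype.val ((tensorEquiv m n).apply_symm_apply
    ⟨alphaPoly m n h f, alphaPoly_mem hh hr f⟩)

/-! ### Partial trace, Hilbert-Schmidt duality and quantum channels -/

section General

variable {H K : Type*} [NormedAddCommGroup H] [InnerProductSpace ℂ H] [FiniteDimensional ℂ H]
  [NormedAddCommGroup K] [InnerProductSpace ℂ K] [FiniteDimensional ℂ K]

/-- The partial trace over the second factor, `A₁ ⊗ A₂ ↦ tr(A₂) A₁`. -/
def partialTrace (H K : Type*) [NormedAddCommGroup H] [InnerProductSpace ℂ H]
    [FiniteDimensional ℂ H] [NormedAddCommGroup K] [InnerProductSpace ℂ K]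
    [FiniteDimensional ℂ K] :
    (H ⊗[ℂ] K →ₗ[ℂ] H ⊗[ℂ] K) →ₗ[ℂ] (H →ₗ[ℂ] H) :=
  (TensorProduct.rid ℂ (H →ₗ[ℂ] H)).toLinearMap ∘ₗ
    LinearMap.lTensor (H →ₗ[ℂ] H) (LinearMap.trace ℂ K) ∘ₗ
      (homTensorHomEquiv ℂ H K H K).symm.toLinearMap

lemma partialTrace_map (A : H →ₗ[ℂ] H) (B : K →ₗ[ℂ] K) :
    partialTrace H K (TensorProduct.map A B) = LinearMap.trace ℂ K B • A := by
  have h : TensorProduct.map A B = homTensorHomEquiv ℂ H K H K (A ⊗ₜ B) := by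
    rw [homTensorHomEquiv_apply]; rfl
  rw [h, partialTrace, LinearMap.comp_apply, LinearMap.comp_apply, LinearEquiv.coe_coe,
    LinearEquiv.coe_coe, LinearEquiv.symm_apply_apply, LinearMap.lTensor_tmul,
    TensorProduct.rid_tmul]

/-- The Hilbert-Schmidt inner product `⟨A | B⟩ = tr(A* B)` on linear maps. -/
@[reducible] def hsCore : InnerProductSpace.Core ℂ (H →ₗ[ℂ] K) where
  inner A B := LinearMap.trace ℂ H (LinearMap.adjoint A ∘ₗ B)
  conj_inner_symm A B := by
    rw [LinearMap.trace_eq_sum_inner _ (stdOrthonormalBasis ℂ H),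
      LinearMap.trace_eq_sum_inner _ (stdOrthonormalBasis ℂ H), map_sum]
    refine Finset.sum_congr rfl fun i _ => ?_
    simp [LinearMap.adjoint_inner_right]
  re_inner_nonneg A := by
    rw [LinearMap.trace_eq_sum_inner _ (stdOrthonormalBasis ℂ H), map_sum]
    refine Finset.sum_nonneg fun i _ => ?_
    rw [LinearMap.comp_apply, LinearMap.adjoint_inner_right]
    exact inner_self_nonneg
  add_left A B C := by
    rw [map_add, LinearMap.add_comp, map_add]
  smul_left A B c := by
    rw [map_smulₛₗ, LinearMap.smul_comp, map_smul, smul_eq_mul]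
  definite A h := by
    change LinearMap.trace ℂ H (LinearMap.adjoint A ∘ₗ A) = 0 at h
    rw [LinearMap.trace_eq_sum_inner _ (stdOrthonormalBasis ℂ H)] at h
    simp only [LinearMap.comp_apply, LinearMap.adjoint_inner_right,
      inner_self_eq_norm_sq_to_K] at h
    have h1 : ∑ i, ‖A (stdOrthonormalBasis ℂ H i)‖ ^ 2 = 0 := by
      rw [← Complex.ofReal_inj]
      simpa using h
    rw [Finset.sum_eq_zero_iff_of_nonneg (fun i _ => by positivity)] at h1
    refine (stdOrthonormalBasis ℂ H).toBasis.ext fun i => ?_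
    simpa using h1 i (Finset.mem_univ i)

instance hsNormedAddCommGroup : NormedAddCommGroup (H →ₗ[ℂ] K) :=
  (hsCore (H := H) (K := K)).toNormedAddCommGroup

instance hsInnerProductSpace : InnerProductSpace ℂ (H →ₗ[ℂ] K) :=
  InnerProductSpace.ofCore (hsCore (H := H) (K := K)).toCore

lemma inner_hs (A B : H →ₗ[ℂ] K) :
    inner ℂ A B = LinearMap.trace ℂ H (LinearMap.adjoint A ∘ₗ B) := rfl

/-- The dual map `Φ* : End(K) → End(H)` of `Φ : End(H) → End(K)`: its adjoint for the
Hilbert-Schmidt inner products. -/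
def dualMap (Φ : (H →ₗ[ℂ] H) →ₗ[ℂ] (K →ₗ[ℂ] K)) : (K →ₗ[ℂ] K) →ₗ[ℂ] (H →ₗ[ℂ] H) :=
  LinearMap.adjoint Φ

/-- The defining property of the dual map: `⟨B | Φ(A)⟩ = ⟨Φ*(B) | A⟩`, and its uniqueness. -/
lemma eq_dualMap_iff (Φ : (H →ₗ[ℂ] H) →ₗ[ℂ] (K →ₗ[ℂ] K)) (Ψ : (K →ₗ[ℂ] K) →ₗ[ℂ] (H →ₗ[ℂ] H)) :
    Ψ = dualMap Φ ↔ ∀ A B, LinearMap.trace ℂ K (LinearMap.adjoint B ∘ₗ Φ A) =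
      LinearMap.trace ℂ H (LinearMap.adjoint (Ψ B) ∘ₗ A) := by
  rw [dualMap, LinearMap.eq_adjoint_iff]
  exact ⟨fun h A B => (h B A).symm, fun h B A => (h A B).symm⟩

/-- `Φ ⊗ id_k : End(H) ⊗ M_k → End(K) ⊗ M_k`, with `End(H) ⊗ M_k` identified with
`End(H ⊗ ℂ^k)`. -/
def ampliation (Φ : (H →ₗ[ℂ] H) →ₗ[ℂ] (K →ₗ[ℂ] K)) (k : ℕ) :
    (H ⊗[ℂ] EuclideanSpace ℂ (Fin k) →ₗ[ℂ] H ⊗[ℂ] EuclideanSpace ℂ (Fin k)) →ₗ[ℂ]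
      (K ⊗[ℂ] EuclideanSpace ℂ (Fin k) →ₗ[ℂ] K ⊗[ℂ] EuclideanSpace ℂ (Fin k)) :=
  (homTensorHomEquiv ℂ K (EuclideanSpace ℂ (Fin k)) K (EuclideanSpace ℂ (Fin k))).toLinearMap ∘ₗ
    LinearMap.rTensor _ Φ ∘ₗ
      (homTensorHomEquiv ℂ H (EuclideanSpace ℂ (Fin k)) H
        (EuclideanSpace ℂ (Fin k))).symm.toLinearMap

/-- Complete positivity: `Φ ⊗ id_k` maps positive operators to positive operators for every
`k ≥ 1`. -/
def IsCompletelyPositive (Φ : (H →ₗ[ℂ] H) →ₗ[ℂ] (K →ₗ[ℂ] K)) : Prop :=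
  ∀ k : ℕ, 1 ≤ k → ∀ A, A.IsPositive → (ampliation Φ k A).IsPositive

/-- A quantum channel is a completely positive trace preserving linear map. -/
def IsChannel (Φ : (H →ₗ[ℂ] H) →ₗ[ℂ] (K →ₗ[ℂ] K)) : Prop :=
  IsCompletelyPositive Φ ∧ ∀ A, LinearMap.trace ℂ K (Φ A) = LinearMap.trace ℂ H A

end General

/-! ### The EPOSIC channels -/

/-- `Φ_{m,n,h} : End(P_r) → End(P_m)`, `A ↦ Tr_{P_n}(α A α*)` with `α = α_{m,n,h}` and
`r = m + n - 2h`. -/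
def Phi (m n h r : ℕ) (hh : h ≤ min m n) (hr : r = m + n - 2 * h) :
    (P r →ₗ[ℂ] P r) →ₗ[ℂ] (P m →ₗ[ℂ] P m) :=
  partialTrace (P m) (P n) ∘ₗ
    LinearMap.lcomp ℂ (P m ⊗[ℂ] P n) (LinearMap.adjoint (alpha m n h r hh hr)) ∘ₗ
      LinearMap.llcomp ℂ (P r) (P r) (P m ⊗[ℂ] P n) (alpha m n h r hh hr)

lemma Phi_apply (m n h r : ℕ) (hh : h ≤ min m n) (hr : r = m + n - 2 * h) (A : P r →ₗ[ℂ] P r) :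
    Phi m n h r hh hr A = partialTrace (P m) (P n)
      (alpha m n h r hh hr ∘ₗ A ∘ₗ LinearMap.adjoint (alpha m n h r hh hr)) := rfl

end

end Eposic

/-!
For `u ∈ P_n` let `V_u : P_r → P_m` be the contraction of `α_{m,n,h}` with `u` in the second
factor, and `W_u : P_m → P_r` that of `α_{r,n,n-h}`. As `u` runs through an orthonormal basis of
`P_n`, the `V_u` are Kraus operators of `Φ_{m,n,h}`, so the `V_u^*` are Kraus operators of
`Φ_{m,n,h}^*`. The point is the symmetry `V_u^* = κ W_{Ju}`, where `|κ|² = (r+1)/(m+1)` and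
`J` is the antiunitary map `p(y₁, y₂) ↦ p̄(-y₂, y₁)` of `P_n`: since `J` sends orthonormal bases
to orthonormal bases, the `W_{Ju}` are again Kraus operators of `Φ_{r,n,n-h}`.

The inner product of `P_m` is the Fischer product, in which powers of linear forms are reproducing
kernels and `∂/∂xᵢ` is adjoint to multiplication by `xᵢ`. The first property reduces the symmetry to
evaluating `α` on powers of linear forms. The second, with the commutation relations of `Γ_{xy}`,
`Δ_{yx}` and their adjoints, shows that `α` is an isometry, hence that `Φ` preserves the trace.
-/

open scoped TensorProduct Nat

namespace Eposic

noncomputable section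

open MvPolynomial

section Kraus

open LinearMap (adjoint)

variable {H K L ι : Type*} [NormedAddCommGroup H] [InnerProductSpace ℂ H] [FiniteDimensional ℂ H]
  [NormedAddCommGroup K] [InnerProductSpace ℂ K] [FiniteDimensional ℂ K]
  [NormedAddCommGroup L] [InnerProductSpace ℂ L] [FiniteDimensional ℂ L] [Fintype ι]

/-- The linear map `A ↦ ∑ₜ Eₜ A Eₜ*` with Kraus operators `Eₜ`. -/
def krausMap (E : ι → H →ₗ[ℂ] K) : (H →ₗ[ℂ] H) →ₗ[ℂ] (K →ₗ[ℂ] K) :=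
  ∑ t, LinearMap.lcomp ℂ K (adjoint (E t)) ∘ₗ LinearMap.llcomp ℂ H H K (E t)

lemma krausMap_apply (E : ι → H →ₗ[ℂ] K) (A : H →ₗ[ℂ] H) :
    krausMap E A = ∑ t, E t ∘ₗ A ∘ₗ adjoint (E t) := by
  simp only [krausMap, LinearMap.sum_apply]
  rfl

lemma krausMap_smul (c : ℂ) (E : ι → H →ₗ[ℂ] K) :
    krausMap (fun t => c • E t) = (c * starRingEnd ℂ c) • krausMap E := by
  refine LinearMap.ext fun A => ?_
  simp only [LinearMap.smul_apply, krausMap_apply, map_smulₛₗ, LinearMap.comp_smul,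
    LinearMap.smul_comp, smul_smul, Finset.smul_sum, mul_comm c]

lemma dualMap_krausMap (E : ι → H →ₗ[ℂ] K) :
    dualMap (krausMap E) = krausMap fun t => adjoint (E t) := by
  symm
  rw [eq_dualMap_iff]
  intro A B
  rw [← inner_hs, ← inner_hs, krausMap_apply, krausMap_apply, inner_sum, sum_inner]
  refine Finset.sum_congr rfl fun t _ => ?_
  simp only [inner_hs, LinearMap.adjoint_comp, LinearMap.adjoint_adjoint]
  rw [← LinearMap.comp_assoc, ← LinearMap.comp_assoc, LinearMap.trace_comp_comm']
  simp only [LinearMap.comp_assoc]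

lemma homTensorHomEquiv_tmul (A : H →ₗ[ℂ] H) (B : K →ₗ[ℂ] K) :
    homTensorHomEquiv ℂ H K H K (A ⊗ₜ B) = TensorProduct.map A B := by
  rw [homTensorHomEquiv_apply]
  rfl

lemma tensorEnd_induction {p : (H ⊗[ℂ] K →ₗ[ℂ] H ⊗[ℂ] K) → Prop} (zero : p 0)
    (add : ∀ M N, p M → p N → p (M + N))
    (map : ∀ (A : H →ₗ[ℂ] H) (B : K →ₗ[ℂ] K), p (TensorProduct.map A B))
    (M : H ⊗[ℂ] K →ₗ[ℂ] H ⊗[ℂ] K) : p M := by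
  obtain ⟨x, rfl⟩ := (homTensorHomEquiv ℂ H K H K).surjective M
  induction x with
  | zero => rwa [map_zero]
  | add x y hx hy => rw [map_add]; exact add _ _ hx hy
  | tmul A B => rw [homTensorHomEquiv_tmul]; exact map A B

lemma ampliation_map (Φ : (H →ₗ[ℂ] H) →ₗ[ℂ] (K →ₗ[ℂ] K)) (k : ℕ) (A : H →ₗ[ℂ] H)
    (B : EuclideanSpace ℂ (Fin k) →ₗ[ℂ] EuclideanSpace ℂ (Fin k)) :
    ampliation Φ k (TensorProduct.map A B) = TensorProduct.map (Φ A) B := by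
  rw [← homTensorHomEquiv_tmul, ← homTensorHomEquiv_tmul]
  simp only [ampliation, LinearMap.comp_apply, LinearEquiv.coe_coe, LinearEquiv.symm_apply_apply,
    LinearMap.rTensor_tmul]

lemma ampliation_krausMap (E : ι → H →ₗ[ℂ] K) (k : ℕ) :
    ampliation (krausMap E) k = krausMap fun t => TensorProduct.map (E t) LinearMap.id := by
  refine LinearMap.ext fun M => ?_
  induction M using tensorEnd_induction with
  | zero => rw [map_zero, map_zero]
  | add M N hM hN => rw [map_add, map_add, hM, hN]
  | map A B =>
    refine TensorProduct.ext' fun v w => ?_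
    simp only [ampliation_map, krausMap_apply, TensorProduct.adjoint_map, LinearMap.adjoint_id,
      LinearMap.sum_apply, LinearMap.comp_apply, TensorProduct.map_tmul, LinearMap.id_apply,
      TensorProduct.sum_tmul]

lemma isCompletelyPositive_krausMap (E : ι → H →ₗ[ℂ] K) : IsCompletelyPositive (krausMap E) := by
  intro k _ M hM
  rw [ampliation_krausMap, krausMap_apply]
  exact LinearMap.isPositive_sum _ fun t _ => hM.conj_adjoint _

lemma trace_partialTrace (M : H ⊗[ℂ] K →ₗ[ℂ] H ⊗[ℂ] K) :
    LinearMap.trace ℂ H (partialTrace H K M) = LinearMap.trace ℂ (H ⊗[ℂ] K) M := by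
  induction M using tensorEnd_induction with
  | zero => simp only [map_zero]
  | add M N hM hN => simp only [map_add, hM, hN]
  | map A B =>
    rw [partialTrace_map, map_smul, LinearMap.trace_tensorProduct', smul_eq_mul, mul_comm]

lemma inner_partialTrace (b : OrthonormalBasis ι ℂ K) (M : H ⊗[ℂ] K →ₗ[ℂ] H ⊗[ℂ] K) (u v : H) :
    inner ℂ u (partialTrace H K M v) = ∑ t, inner ℂ (u ⊗ₜ[ℂ] b t) (M (v ⊗ₜ[ℂ] b t)) := by
  induction M using tensorEnd_induction with
  | zero => simp only [map_zero, LinearMap.zero_apply, inner_zero_right, Finset.sum_const_zero]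
  | add M N hM hN =>
    simp only [map_add, LinearMap.add_apply, inner_add_right, hM, hN, Finset.sum_add_distrib]
  | map A B =>
    simp only [partialTrace_map, LinearMap.smul_apply, inner_smul_right,
      LinearMap.trace_eq_sum_inner B b, Finset.sum_mul, TensorProduct.map_tmul,
      TensorProduct.inner_tmul, mul_comm (inner ℂ u (A v))]

/-- The contraction `(1 ⊗ ⟨u|) ∘ α` of a map `α : L → H ⊗ K` with a vector `u` of the second factor,
as a conjugate linear function of `u`. For `u` in an orthonormal basis these are the Kraus operators
of `A ↦ Tr_K (α A α*)`. -/
def contract (α : L →ₗ[ℂ] H ⊗[ℂ] K) : K →ₗ⋆[ℂ] (L →ₗ[ℂ] H) :=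
  (adjoint : (H →ₗ[ℂ] L) ≃ₗ⋆[ℂ] (L →ₗ[ℂ] H)).toLinearMap.comp
    ((TensorProduct.mk ℂ H K).compr₂ (adjoint α)).flip

lemma adjoint_contract_apply (α : L →ₗ[ℂ] H ⊗[ℂ] K) (u : K) (v : H) :
    adjoint (contract α u) v = adjoint α (v ⊗ₜ u) :=
  DFunLike.congr_fun (LinearMap.adjoint_adjoint _) v

lemma inner_contract_apply (α : L →ₗ[ℂ] H ⊗[ℂ] K) (u : K) (v : H) (f : L) :
    inner ℂ v (contract α u f) = inner ℂ (v ⊗ₜ[ℂ] u) (α f) := by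
  rw [← LinearMap.adjoint_inner_left, adjoint_contract_apply, LinearMap.adjoint_inner_left]

lemma partialTrace_conj (b : OrthonormalBasis ι ℂ K) (α : L →ₗ[ℂ] H ⊗[ℂ] K) (A : L →ₗ[ℂ] L) :
    partialTrace H K (α ∘ₗ A ∘ₗ adjoint α) = krausMap (fun t => contract α (b t)) A := by
  refine LinearMap.ext fun v => ext_inner_left ℂ fun u => ?_
  simp only [inner_partialTrace b, krausMap_apply, LinearMap.sum_apply, inner_sum,
    LinearMap.comp_apply, inner_contract_apply, adjoint_contract_apply]

end Kraus

lemma cgCoeff_zero_eq (p q : ℕ) :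
    cgCoeff p q 0 = (p ! * (p + q + 1) : ℝ) / (q ! * (p + q + 1)!) := by
  induction q generalizing p with
  | zero =>
    simp only [cgCoeff, Nat.factorial_succ, Nat.factorial_zero, add_zero]
    push_cast
    field_simp
    ring
  | succ q ih =>
    rw [cgCoeff, ih, add_right_comm p 1 q, add_assoc p q 1, Nat.factorial_succ p,
      Nat.factorial_succ q]
    push_cast
    field_simp
    ring

lemma cgCoeff_eq : ∀ h p q : ℕ, cgCoeff (h + p) (h + q) h =
    (p ! * (p + q + 1) : ℝ) / (h ! * q ! * (p + q + h + 1)!)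
  | 0, p, q => by simp [cgCoeff_zero_eq]
  | h + 1, p, 0 => by
    have ih : cgCoeff (h + p) h h = (p ! * (p + 1) : ℝ) / (h ! * (p + h + 1)!) := by
      simpa using cgCoeff_eq h p 0
    rw [add_zero, cgCoeff, if_neg (lt_irrefl _), show h + 1 + p - 1 = h + p by omega, ih,
      show p + 0 + (h + 1) + 1 = p + h + 1 + 1 by ring, Nat.factorial_succ (p + h + 1),
      Nat.factorial_succ h]
    push_cast
    field_simp
    ring
  | h + 1, p, q + 1 => by
    have ih₁ : cgCoeff (h + p) (h + 1 + q) h =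
        (p ! * (p + q + 2) : ℝ) / (h ! * ((q + 1) * q !) * (p + q + h + 2)!) := by
      rw [add_right_comm, add_assoc, cgCoeff_eq, Nat.factorial_succ q,
        show p + (q + 1) + h + 1 = p + q + h + 2 by ring]
      push_cast
      ring
    have ih₂ : cgCoeff (h + 1 + p + 1) (h + 1 + q) (h + 1) = ((p + 1) * p ! * (p + q + 2) : ℝ) /
        ((h + 1) * h ! * q ! * ((p + q + h + 3) * (p + q + h + 2)!)) := by
      rw [add_assoc (h + 1) p, cgCoeff_eq, Nat.factorial_succ p, Nat.factorial_succ h,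
        show p + 1 + q + (h + 1) + 1 = p + q + h + 2 + 1 by ring,
        Nat.factorial_succ (p + q + h + 2)]
      push_cast
      ring
    rw [← add_assoc, cgCoeff, if_pos (by omega), show h + 1 + p - 1 = h + p by omega, ih₁, ih₂,
      show p + (q + 1) + (h + 1) + 1 = p + q + h + 2 + 1 by ring, Nat.factorial_succ q,
      Nat.factorial_succ h, Nat.factorial_succ (p + q + h + 2)]
    push_cast
    field_simp
    ring

lemma cgCoeff_swap (h h' p : ℕ) : cgCoeff (h + p) (h + h') h =
    ((h' + p + 1 : ℝ) / (h + p + 1)) * cgCoeff (h' + p) (h' + h) h' := by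
  rw [cgCoeff_eq, cgCoeff_eq, add_right_comm p h h']
  field_simp
  ring

lemma cgCoeff_mul_eq_one (h p q : ℕ) : cgCoeff (h + p) (h + q) h *
    ((h ! * (p + q + 2).ascFactorial h : ℕ) * (q ! * (p + q).descFactorial q : ℕ)) = 1 := by
  have hasc : ((p + q + 1) * (p + q)! * (p + q + 2).ascFactorial h : ℝ) = (p + q + h + 1)! := by
    rw [add_right_comm (p + q), ← Nat.factorial_mul_ascFactorial (p + q + 1) h,
      Nat.factorial_succ (p + q)]
    push_cast
    rfl
  have hdesc : (p ! * (p + q).descFactorial q : ℝ) = (p + q)! := by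
    simpa using congrArg (Nat.cast (R := ℝ)) (Nat.factorial_mul_descFactorial (Nat.le_add_left q p))
  rw [cgCoeff_eq, div_mul_eq_mul_div, div_eq_one_iff_eq (by positivity), ← hasc, ← hdesc]
  push_cast
  ring

section Fischer

variable {σ R : Type*} [CommRing R]

lemma pderiv_comm (i j : σ) (F : MvPolynomial σ R) :
    pderiv i (pderiv j F) = pderiv j (pderiv i F) := by
  classical
  ext d
  rw [coeff_pderiv, coeff_pderiv, coeff_pderiv, coeff_pderiv, add_right_comm d]
  rcases eq_or_ne i j with rfl | h
  · rfl
  · simp only [Finsupp.add_apply, Finsupp.single_eq_of_ne h, Finsupp.single_eq_of_ne' h,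
      add_zero]
    exact mul_right_comm _ _ _

lemma pderiv_rename_of_notMem_range {τ : Type*} {f : σ → τ} {j : τ} (hj : j ∉ Set.range f)
    (F : MvPolynomial σ R) : pderiv j (rename f F) = 0 := by
  classical
  refine pderiv_eq_zero_of_notMem_vars fun h => hj ?_
  obtain ⟨i, -, hi⟩ := Finset.mem_image.1 (vars_rename f F h)
  exact ⟨i, hi⟩

/-- The multi-index factorial `d! = ∏ᵢ (dᵢ)!`. -/
def multiFactorial (d : σ →₀ ℕ) : ℕ := d.prod fun _ k => k !

lemma multiFactorial_add_single (d : σ →₀ ℕ) (i : σ) :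
    multiFactorial (d + Finsupp.single i 1) = (d i + 1) * multiFactorial d := by
  classical
  have hd (e : σ →₀ ℕ) : multiFactorial e = (e i)! * multiFactorial (e.erase i) :=
    (Finsupp.mul_prod_erase' e i _ fun _ => Nat.factorial_zero).symm
  rw [hd, hd d, Finsupp.erase_add, Finsupp.erase_single, add_zero, Finsupp.add_apply,
    Finsupp.single_eq_same, Nat.factorial_succ, mul_assoc]

variable [StarRing R]

/-- The Fischer form: the sesquilinear form, conjugate linear in the first variable, for which the
monomials `X ^ d` are orthogonal with `⟨X ^ d, X ^ d⟩ = d!`. -/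
def fischer : MvPolynomial σ R →ₗ⋆[R] MvPolynomial σ R →ₗ[R] R :=
  ((basisMonomials σ R).constr R fun d => (multiFactorial d : R) •
    (starLinearEquiv R : R ≃ₗ⋆[R] R).toLinearMap.comp (lcoeff R d)).flip

lemma fischer_monomial_right (F : MvPolynomial σ R) (d : σ →₀ ℕ) (c : R) :
    fischer F (monomial d c) = multiFactorial d * (starRingEnd R (coeff d F) * c) := by
  have hd : (monomial d c : MvPolynomial σ R) = c • basisMonomials σ R d := by
    rw [coe_basisMonomials, smul_monomial, smul_eq_mul, mul_one]
  rw [hd, map_smul, fischer, LinearMap.flip_apply, Module.Basis.constr_basis]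
  simp only [LinearMap.smul_apply, LinearMap.comp_apply, lcoeff_apply, smul_eq_mul]
  rw [mul_left_comm, mul_comm c]
  rfl

lemma conj_fischer (F G : MvPolynomial σ R) : starRingEnd R (fischer F G) = fischer G F := by
  classical
  induction F using MvPolynomial.induction_on' with
  | add p q hp hq => rw [map_add, map_add, LinearMap.add_apply, map_add, hp, hq]
  | monomial d a =>
    induction G using MvPolynomial.induction_on' with
    | add p q hp hq => rw [map_add, map_add, map_add, LinearMap.add_apply, hp, hq]
    | monomial e b =>
      rw [fischer_monomial_right, fischer_monomial_right, coeff_monomial, coeff_monomial]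
      rcases eq_or_ne d e with rfl | h
      · simp only [↓reduceIte, map_mul, map_natCast, starRingEnd_self_apply, mul_comm a]
      · simp only [h, h.symm, ↓reduceIte, map_zero, zero_mul, mul_zero]

lemma fischer_pderiv_left (i : σ) (F G : MvPolynomial σ R) :
    fischer (pderiv i F) G = fischer F (X i * G) := by
  induction G using MvPolynomial.induction_on' with
  | add p q hp hq => rw [map_add, mul_add, map_add, hp, hq]
  | monomial d a =>
    rw [X, monomial_mul, one_mul, add_comm, fischer_monomial_right, fischer_monomial_right,
      multiFactorial_add_single, coeff_pderiv]
    simp only [map_mul, map_add, map_natCast, map_one, Nat.cast_mul, Nat.cast_add, Nat.cast_one]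
    ring

lemma fischer_X_mul_left (i : σ) (F G : MvPolynomial σ R) :
    fischer (X i * F) G = fischer F (pderiv i G) := by
  rw [← conj_fischer, ← fischer_pderiv_left, conj_fischer]

lemma fischer_C_left (a : R) (G : MvPolynomial σ R) :
    fischer (C a) G = starRingEnd R a * constantCoeff G := by
  rw [← conj_fischer, C_apply, fischer_monomial_right]
  simp [multiFactorial, constantCoeff_eq, mul_comm]

lemma fischer_C_mul_left (a : R) (F G : MvPolynomial σ R) :
    fischer (C a * F) G = starRingEnd R a * fischer F G := by
  rw [C_mul', map_smulₛₗ, LinearMap.smul_apply, smul_eq_mul]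

lemma fischer_rename_mul_rename {τ : Type*} (F F' : MvPolynomial σ R) (G G' : MvPolynomial τ R) :
    fischer (rename Sum.inl F * rename Sum.inr G) (rename Sum.inl F' * rename Sum.inr G') =
      fischer F F' * fischer G G' := by
  induction F using MvPolynomial.induction_on generalizing F' with
  | add p q hp hq => simp only [map_add, add_mul, LinearMap.add_apply, hp, hq]
  | mul_X F i ih =>
    have hG' : pderiv (Sum.inl i) (rename Sum.inr G' : MvPolynomial (σ ⊕ τ) R) = 0 :=
      pderiv_rename_of_notMem_range (by simp) G'
    rw [mul_comm F, map_mul (rename _), rename_X, mul_assoc, fischer_X_mul_left, fischer_X_mul_left,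
      Derivation.leibniz, hG', smul_zero, zero_add, smul_eq_mul, mul_comm (rename Sum.inr G'),
      pderiv_rename Sum.inl_injective, ih]
  | C a =>
    rw [rename_C, fischer_C_mul_left, fischer_C_left, mul_assoc]
    congr 1
    induction G using MvPolynomial.induction_on generalizing G' with
    | add p q hp hq => simp only [map_add, LinearMap.add_apply, mul_add, hp, hq]
    | mul_X G i ih =>
      have hF' : pderiv (Sum.inr i) (rename Sum.inl F' : MvPolynomial (σ ⊕ τ) R) = 0 :=
        pderiv_rename_of_notMem_range (by simp) F'
      rw [mul_comm G, map_mul (rename _), rename_X, fischer_X_mul_left, fischer_X_mul_left,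
        Derivation.leibniz, hF', smul_zero, add_zero, smul_eq_mul,
        pderiv_rename Sum.inr_injective, ih]
    | C b =>
      rw [rename_C, fischer_C_left, fischer_C_left, map_mul, constantCoeff_rename,
        constantCoeff_rename, mul_left_comm]

lemma fischer_sum_pow_left [Fintype σ] (a : σ → R) {m : ℕ} {F : MvPolynomial σ R}
    (hF : F.IsHomogeneous m) :
    fischer ((∑ i, C (a i) * X i) ^ m) F = m ! * eval (fun i => starRingEnd R (a i)) F := by
  induction m generalizing F with
  | zero =>
    have hC : F = C (coeff 0 F) := totalDegree_eq_zero_iff_eq_C.1 (Nat.le_zero.1 hF.totalDegree_le)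
    rw [pow_zero, ← C_1, fischer_C_left, hC]
    simp
  | succ m ih =>
    calc fischer ((∑ i, C (a i) * X i) ^ (m + 1)) F
        = ∑ i, starRingEnd R (a i) * fischer ((∑ i, C (a i) * X i) ^ m) (pderiv i F) := by
          simp only [pow_succ', Finset.sum_mul, map_sum, LinearMap.sum_apply, mul_assoc,
            fischer_C_mul_left, fischer_X_mul_left]
      _ = m ! * eval (fun i => starRingEnd R (a i)) (∑ i, X i * pderiv i F) := by
          simp only [ih hF.pderiv, map_sum, map_mul, eval_X, Finset.mul_sum, mul_left_comm]
      _ = (m + 1)! * eval (fun i => starRingEnd R (a i)) F := by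
          rw [hF.sum_X_mul_pderiv, map_nsmul, nsmul_eq_mul, Nat.factorial_succ]
          push_cast
          ring

end Fischer

lemma inner_eq_fischer {m : ℕ} (f g : P m) :
    inner ℂ f g = fischer (f : MvPolynomial (Fin 2) ℂ) (g : MvPolynomial (Fin 2) ℂ) := by
  have hmono (l : Fin (m + 1)) : fischer (f : MvPolynomial (Fin 2) ℂ) (mono m l) =
      ((l : ℕ)! * (m - l)! : ℕ) * starRingEnd ℂ (cf l f) := by
    rw [mono, fischer_monomial_right, mul_one]
    simp [cf, multiFactorial, Finsupp.prod_fintype, expo_zero, expo_one]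
  conv_rhs => rw [sum_mono g]
  rw [inner_P, Finset.sum_range, Submodule.coe_sum, map_sum]
  refine Finset.sum_congr rfl fun l _ => ?_
  rw [Submodule.coe_smul, map_smul, hmono, smul_eq_mul]
  ring

lemma inner_tensor_eq_fischer {m n : ℕ} (t t' : P m ⊗[ℂ] P n) :
    inner ℂ t t' = fischer (tensorToPxy m n t) (tensorToPxy m n t') := by
  induction t with
  | zero => rw [inner_zero_left, map_zero, map_zero, LinearMap.zero_apply]
  | add x y hx hy => rw [inner_add_left, map_add, map_add, LinearMap.add_apply, hx, hy]
  | tmul f g =>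
    induction t' with
    | zero => rw [inner_zero_right, map_zero, map_zero]
    | add x y hx hy => rw [inner_add_right, map_add, map_add, hx, hy]
    | tmul f' g' =>
      rw [TensorProduct.inner_tmul, tensorToPxy_tmul, tensorToPxy_tmul, fischer_rename_mul_rename,
        inner_eq_fischer, inner_eq_fischer]

/-- Cayley's operator `∂²/∂x₁∂y₂ - ∂²/∂y₁∂x₂`, the Fischer adjoint of `Γ_{xy}`. -/
def omegaXY : Pxy →ₗ[ℂ] Pxy :=
  (pderiv (Sum.inl 0)).toLinearMap ∘ₗ (pderiv (Sum.inr 1)).toLinearMap -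
    (pderiv (Sum.inr 0)).toLinearMap ∘ₗ (pderiv (Sum.inl 1)).toLinearMap

/-- `Δ_{xy} = x₁ ∂/∂y₁ + x₂ ∂/∂y₂`, the Fischer adjoint of `Δ_{yx}`. -/
def deltaXY : Pxy →ₗ[ℂ] Pxy :=
  LinearMap.mulLeft ℂ (X (Sum.inl 0)) ∘ₗ (pderiv (Sum.inr 0)).toLinearMap +
    LinearMap.mulLeft ℂ (X (Sum.inl 1)) ∘ₗ (pderiv (Sum.inr 1)).toLinearMap

lemma omegaXY_apply (F : Pxy) : omegaXY F =
    pderiv (Sum.inl 0) (pderiv (Sum.inr 1) F) - pderiv (Sum.inr 0) (pderiv (Sum.inl 1) F) := rfl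

lemma deltaXY_apply (F : Pxy) : deltaXY F =
    X (Sum.inl 0) * pderiv (Sum.inr 0) F + X (Sum.inl 1) * pderiv (Sum.inr 1) F := rfl

lemma deltaYX_apply (F : Pxy) : deltaYX F =
    X (Sum.inr 0) * pderiv (Sum.inl 0) F + X (Sum.inr 1) * pderiv (Sum.inl 1) F := rfl

lemma gammaXY_apply (F : Pxy) : gammaXY F =
    (X (Sum.inl 0) * X (Sum.inr 1) - X (Sum.inr 0) * X (Sum.inl 1)) * F := rfl

lemma fischer_omegaXY_left (F G : Pxy) : fischer (omegaXY F) G = fischer F (gammaXY G) := by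
  rw [omegaXY_apply, map_sub, LinearMap.sub_apply, fischer_pderiv_left, fischer_pderiv_left,
    fischer_pderiv_left, fischer_pderiv_left, ← map_sub, gammaXY_apply]
  congr 1
  ring

lemma fischer_deltaXY_left (F G : Pxy) : fischer (deltaXY F) G = fischer F (deltaYX G) := by
  rw [deltaXY_apply, map_add, LinearMap.add_apply, fischer_X_mul_left, fischer_X_mul_left,
    fischer_pderiv_left, fischer_pderiv_left, ← map_add, deltaYX_apply]

lemma isWeightedHomogeneous_comp {σ R M N : Type*} [CommSemiring R] [AddCommMonoid M]
    [AddCommMonoid N] (g : M →+ N) {w : σ → M} {n : M} {F : MvPolynomial σ R}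
    (hF : IsWeightedHomogeneous w F n) : IsWeightedHomogeneous (g ∘ w) F (g n) := fun d hd => by
  rw [← hF hd, Finsupp.weight_apply, Finsupp.weight_apply, map_finsuppSum]
  simp only [Function.comp_apply, map_nsmul]

lemma euler_inl {a b : ℕ} {F : Pxy} (hF : F ∈ BiP a b) :
    X (Sum.inl 0) * pderiv (Sum.inl 0) F + X (Sum.inl 1) * pderiv (Sum.inl 1) F =
      (a : Pxy) * F := by
  simpa [bideg] using (isWeightedHomogeneous_comp (AddMonoidHom.fst ℕ ℕ) hF).sum_weight_X_mul_pderiv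

lemma euler_inr {a b : ℕ} {F : Pxy} (hF : F ∈ BiP a b) :
    X (Sum.inr 0) * pderiv (Sum.inr 0) F + X (Sum.inr 1) * pderiv (Sum.inr 1) F =
      (b : Pxy) * F := by
  simpa [bideg] using (isWeightedHomogeneous_comp (AddMonoidHom.snd ℕ ℕ) hF).sum_weight_X_mul_pderiv

lemma omegaXY_gammaXY {a b : ℕ} {F : Pxy} (hF : F ∈ BiP a b) :
    omegaXY (gammaXY F) = gammaXY (omegaXY F) + (a + b + 2) • F := by
  rw [nsmul_eq_mul, Nat.cast_add, Nat.cast_add, add_mul, add_mul, ← euler_inl hF, ← euler_inr hF,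
    Nat.cast_ofNat]
  simp only [omegaXY_apply, gammaXY_apply, pderiv_mul, map_add, map_sub, pderiv_X, Pi.single_apply,
    reduceCtorEq, Sum.inl.injEq, Sum.inr.injEq, zero_ne_one, one_ne_zero, ↓reduceIte, map_zero,
    pderiv_one]
  ring

lemma deltaXY_deltaYX {a b : ℕ} {F : Pxy} (hF : F ∈ BiP a b) :
    deltaXY (deltaYX F) = deltaYX (deltaXY F) + ((a : ℂ) - b) • F := by
  rw [smul_eq_C_mul, C_sub, map_natCast, map_natCast, sub_mul, ← euler_inl hF, ← euler_inr hF]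
  simp only [deltaXY_apply, deltaYX_apply, pderiv_mul, map_add, pderiv_X, Pi.single_apply,
    Sum.inl.injEq, Sum.inr.injEq, zero_ne_one, one_ne_zero, ↓reduceIte,
    pderiv_comm (Sum.inr _) (Sum.inl _)]
  ring

lemma omegaXY_deltaYX (F : Pxy) : omegaXY (deltaYX F) = deltaYX (omegaXY F) := by
  simp only [omegaXY_apply, deltaYX_apply, pderiv_mul, map_add, map_sub, pderiv_X, Pi.single_apply,
    reduceCtorEq, Sum.inr.injEq, zero_ne_one, one_ne_zero, ↓reduceIte, map_zero, pderiv_one,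
    pderiv_comm (Sum.inr _) (Sum.inl _),
    pderiv_comm (Sum.inl 1 : Fin 2 ⊕ Fin 2) (Sum.inl 0)]
  ring

lemma omegaXY_gammaXY_pow {a b : ℕ} {F : Pxy} (hF : F ∈ BiP a b) (h0 : omegaXY F = 0) (h : ℕ) :
    omegaXY ((gammaXY ^ (h + 1)) F) = ((h + 1) * (a + b + 2 + h)) • (gammaXY ^ h) F := by
  induction h with
  | zero => simp [omegaXY_gammaXY hF, h0]
  | succ h ih =>
    rw [pow_succ', Module.End.mul_apply, omegaXY_gammaXY (gammaXY_pow_mem (h + 1) hF), ih,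
      map_nsmul, ← Module.End.mul_apply, ← pow_succ', ← add_smul]
    congr 1
    ring

lemma deltaXY_deltaYX_pow {r : ℕ} {F : Pxy} (hF : F ∈ BiP r 0) (h0 : deltaXY F = 0) {k : ℕ}
    (hk : k ≤ r) :
    deltaXY ((deltaYX ^ (k + 1)) F) = ((k + 1) * (r - k)) • (deltaYX ^ k) F := by
  induction k with
  | zero => simp [deltaXY_deltaYX hF, h0, Nat.cast_smul_eq_nsmul]
  | succ k ih =>
    obtain ⟨a, rfl⟩ := Nat.exists_eq_add_of_le' hk
    rw [pow_succ', Module.End.mul_apply, deltaXY_deltaYX (deltaYX_pow_mem (k + 1) hF),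
      ih (by omega), map_nsmul, ← Module.End.mul_apply, ← pow_succ', ← Nat.cast_smul_eq_nsmul ℂ,
      ← Nat.cast_smul_eq_nsmul ℂ, ← add_smul, Nat.add_sub_cancel,
      show a + (k + 1) - k = a + 1 by omega]
    congr 1
    push_cast
    ring

lemma fischer_gammaXY_pow {a b : ℕ} {F : Pxy} (hF : F ∈ BiP a b) (h0 : omegaXY F = 0) (G : Pxy)
    (h : ℕ) : fischer ((gammaXY ^ h) F) ((gammaXY ^ h) G) =
      (h ! * (a + b + 2).ascFactorial h : ℕ) * fischer F G := by
  induction h with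
  | zero => simp
  | succ h ih =>
    rw [pow_succ' _ h, Module.End.mul_apply _ _ G, ← fischer_omegaXY_left,
      ← pow_succ', omegaXY_gammaXY_pow hF h0, map_nsmul, LinearMap.smul_apply, ih,
      nsmul_eq_mul, ← mul_assoc, ← Nat.cast_mul, Nat.factorial_succ, Nat.ascFactorial_succ]
    congr 2
    ring

lemma fischer_deltaYX_pow {r : ℕ} {F : Pxy} (hF : F ∈ BiP r 0) (h0 : deltaXY F = 0) (G : Pxy)
    {k : ℕ} (hk : k ≤ r) : fischer ((deltaYX ^ k) F) ((deltaYX ^ k) G) =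
      (k ! * r.descFactorial k : ℕ) * fischer F G := by
  induction k with
  | zero => simp
  | succ k ih =>
    have hk' : k ≤ r := le_of_lt hk
    rw [pow_succ' _ k, Module.End.mul_apply _ _ G, ← fischer_deltaXY_left,
      ← pow_succ', deltaXY_deltaYX_pow hF h0 hk', map_nsmul, LinearMap.smul_apply, ih hk',
      nsmul_eq_mul, ← mul_assoc, ← Nat.cast_mul, Nat.factorial_succ, Nat.descFactorial_succ]
    congr 2
    ring

lemma pderiv_inr_rename_inl (i : Fin 2) (f : MvPolynomial (Fin 2) ℂ) :
    pderiv (Sum.inr i) (rename Sum.inl f : Pxy) = 0 :=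
  pderiv_rename_of_notMem_range (by simp) f

lemma deltaXY_rename_inl (f : MvPolynomial (Fin 2) ℂ) : deltaXY (rename Sum.inl f) = 0 := by
  simp only [deltaXY_apply, pderiv_inr_rename_inl, mul_zero, add_zero]

lemma omegaXY_deltaYX_pow_rename_inl (f : MvPolynomial (Fin 2) ℂ) (k : ℕ) :
    omegaXY ((deltaYX ^ k) (rename Sum.inl f)) = 0 := by
  induction k with
  | zero => simp only [pow_zero, Module.End.one_apply, omegaXY_apply,
      pderiv_comm (Sum.inr 0 : Fin 2 ⊕ Fin 2), pderiv_inr_rename_inl, map_zero, sub_zero]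
  | succ k ih => rw [pow_succ', Module.End.mul_apply, omegaXY_deltaYX, ih, map_zero]

lemma inner_eq_fischer_rename_inl {m : ℕ} (f g : P m) : inner ℂ f g =
    fischer (rename Sum.inl (f : MvPolynomial (Fin 2) ℂ) : Pxy) (rename Sum.inl g.1) := by
  have hone : fischer (1 : MvPolynomial (Fin 2) ℂ) 1 = 1 := by
    rw [← C_1, fischer_C_left, map_one, constantCoeff_C, one_mul]
  simpa only [map_one, mul_one, hone, inner_eq_fischer] using
    (fischer_rename_mul_rename f.1 g.1 (1 : MvPolynomial (Fin 2) ℂ) 1).symm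

lemma inner_alpha_alpha (m n h r : ℕ) (hh : h ≤ min m n) (hr : r = m + n - 2 * h) (f g : P r) :
    inner ℂ (alpha m n h r hh hr f) (alpha m n h r hh hr g) = inner ℂ f g := by
  obtain ⟨p, rfl⟩ := Nat.exists_eq_add_of_le (hh.trans (min_le_left _ _))
  obtain ⟨q, rfl⟩ := Nat.exists_eq_add_of_le (hh.trans (min_le_right _ _))
  obtain rfl : r = p + q := by omega
  have hc : (√(cgCoeff (h + p) (h + q) h) : ℂ) * √(cgCoeff (h + p) (h + q) h) =
      cgCoeff (h + p) (h + q) h := by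
    rw [← Complex.ofReal_mul, Real.mul_self_sqrt]
    rw [cgCoeff_eq]
    positivity
  have hone := congrArg ((↑) : ℝ → ℂ) (cgCoeff_mul_eq_one h p q)
  rw [inner_tensor_eq_fischer, tensorToPxy_alpha, tensorToPxy_alpha, map_smulₛₗ, map_smulₛₗ,
    RingHom.id_apply, LinearMap.smul_apply, smul_smul, Complex.conj_ofReal, hc,
    Nat.add_sub_cancel_left, fischer_gammaXY_pow (deltaYX_pow_mem q (rename_inl_mem f))
      (omegaXY_deltaYX_pow_rename_inl _ q),
    fischer_deltaYX_pow (rename_inl_mem f) (deltaXY_rename_inl _) _ (Nat.le_add_left q p),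
    ← inner_eq_fischer_rename_inl, zero_add, smul_eq_mul, ← mul_assoc, ← mul_assoc]
  push_cast at hone ⊢
  rw [← mul_assoc] at hone
  rw [hone, one_mul]

lemma adjoint_alpha_comp_alpha (m n h r : ℕ) (hh : h ≤ min m n) (hr : r = m + n - 2 * h) :
    LinearMap.adjoint (alpha m n h r hh hr) ∘ₗ alpha m n h r hh hr = LinearMap.id := by
  refine LinearMap.ext fun v => ext_inner_left ℂ fun u => ?_
  rw [LinearMap.comp_apply, LinearMap.adjoint_inner_right, inner_alpha_alpha, LinearMap.id_apply]

/-- The power `(a₁ x₁ + a₂ x₂) ^ m` of a linear form. -/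
def linPow (a : Fin 2 → ℂ) (m : ℕ) : P m :=
  ⟨(∑ i, C (a i) * X i) ^ m, by
    simpa using (IsHomogeneous.sum Finset.univ _ 1 fun i _ => isHomogeneous_C_mul_X (a i) i).pow m⟩

lemma coe_linPow (a : Fin 2 → ℂ) (m : ℕ) :
    (linPow a m : MvPolynomial (Fin 2) ℂ) = (∑ i, C (a i) * X i) ^ m := rfl

lemma eval_linPow (a v : Fin 2 → ℂ) (m : ℕ) :
    eval v (linPow a m : MvPolynomial (Fin 2) ℂ) = (a ⬝ᵥ v) ^ m := by
  simp only [coe_linPow, map_pow, map_sum, map_mul, eval_C, eval_X, dotProduct]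

lemma inner_linPow (a : Fin 2 → ℂ) {m : ℕ} (f : P m) : inner ℂ (linPow a m) f =
    m ! * eval (fun i => starRingEnd ℂ (a i)) (f : MvPolynomial (Fin 2) ℂ) := by
  rw [inner_eq_fischer, coe_linPow, fischer_sum_pow_left a f.2]

lemma inner_linPow_tmul (a b : Fin 2 → ℂ) {m n : ℕ} (t : P m ⊗[ℂ] P n) :
    inner ℂ (linPow a m ⊗ₜ[ℂ] linPow b n) t = (m ! * n ! : ℕ) *
      eval (Sum.elim (fun i => starRingEnd ℂ (a i)) (fun i => starRingEnd ℂ (b i)))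
        (tensorToPxy m n t) := by
  induction t with
  | zero => rw [inner_zero_right, map_zero, map_zero, mul_zero]
  | add t t' h h' => rw [inner_add_right, h, h', map_add, map_add, mul_add]
  | tmul f g =>
    rw [TensorProduct.inner_tmul, inner_linPow, inner_linPow, tensorToPxy_tmul, map_mul,
      eval_rename, eval_rename, Sum.elim_comp_inl, Sum.elim_comp_inr, Nat.cast_mul,
      mul_mul_mul_comm]

lemma ext_inner_linPow {m : ℕ} {f g : P m}
    (h : ∀ a, inner ℂ (linPow a m) f = inner ℂ (linPow a m) g) : f = g := by
  refine Subtype.ext (MvPolynomial.funext fun x => ?_)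
  have hx := h fun i => starRingEnd ℂ (x i)
  rw [inner_linPow, inner_linPow] at hx
  simpa only [Complex.conj_conj] using
    mul_left_cancel₀ (Nat.cast_ne_zero.2 (Nat.factorial_ne_zero m)) hx

lemma span_range_linPow (m : ℕ) : Submodule.span ℂ (Set.range fun a => linPow a m) = ⊤ := by
  rw [← Submodule.orthogonal_eq_bot_iff, Submodule.eq_bot_iff]
  intro g hg
  refine ext_inner_linPow fun a => ?_
  rw [inner_zero_right]
  exact hg _ (Submodule.subset_span ⟨a, rfl⟩)

lemma deltaYX_pow_linPow (d : Fin 2 → ℂ) (p k : ℕ) :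
    (deltaYX ^ k) (rename Sum.inl (linPow d (p + k) : MvPolynomial (Fin 2) ℂ)) =
      (p + k).descFactorial k •
        ((∑ i, C (d i) * X (Sum.inr i)) ^ k * (∑ i, C (d i) * X (Sum.inl i)) ^ p) := by
  induction k generalizing p with
  | zero => simp [coe_linPow]
  | succ k ih =>
    rw [← add_assoc, add_right_comm, pow_succ', Module.End.mul_apply, ih, map_nsmul,
      Nat.descFactorial_succ, Nat.add_sub_cancel, mul_comm (p + 1), mul_smul, nsmul_eq_mul (p + 1)]
    simp only [deltaYX_apply, pderiv_mul, pderiv_pow, map_add, pderiv_X, pderiv_C, Fin.sum_univ_two,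
      Pi.single_apply, reduceCtorEq, Sum.inl.injEq, zero_ne_one, one_ne_zero, ↓reduceIte]
    push_cast
    ring

lemma eval_gammaXY_pow (v : Fin 2 ⊕ Fin 2 → ℂ) (F : Pxy) (h : ℕ) : eval v ((gammaXY ^ h) F) =
    (v (Sum.inl 0) * v (Sum.inr 1) - v (Sum.inr 0) * v (Sum.inl 1)) ^ h * eval v F := by
  induction h with
  | zero => rw [pow_zero, pow_zero, one_mul, Module.End.one_apply]
  | succ h ih =>
    rw [pow_succ', Module.End.mul_apply, gammaXY_apply, map_mul, ih, pow_succ', mul_assoc]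
    simp only [map_sub, map_mul, eval_X]

lemma eval_alpha_linPow {m n h r p q : ℕ} (hm : m = h + p) (hn : n = h + q) (hpq : r = p + q)
    (hh : h ≤ min m n) (hr : r = m + n - 2 * h) (d x y : Fin 2 → ℂ) :
    eval (Sum.elim x y) (tensorToPxy m n (alpha m n h r hh hr (linPow d r))) =
      √(cgCoeff m n h) * r.descFactorial q *
        ((x 0 * y 1 - y 0 * x 1) ^ h * (d ⬝ᵥ y) ^ q * (d ⬝ᵥ x) ^ p) := by
  subst hm hn hpq
  rw [tensorToPxy_alpha, smul_eval, eval_gammaXY_pow, Nat.add_sub_cancel_left, deltaYX_pow_linPow]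
  simp only [map_natCast, map_mul, map_pow, map_sum, eval_C, eval_X, Sum.elim_inl, Sum.elim_inr,
    dotProduct, nsmul_eq_mul]
  ring

/-- The antiunitary map `p(y₁, y₂) ↦ p̄(-y₂, y₁)` of `P n`, where `p̄` has the conjugate
coefficients. -/
def twist (n : ℕ) : P n →ₗ⋆[ℂ] P n where
  toFun p := ⟨aeval ![-X 1, X 0] (map (starRingEnd ℂ) p.1), by
    have hX (i : Fin 2) : (![-X 1, X 0] i : MvPolynomial (Fin 2) ℂ).IsHomogeneous 1 := by
      fin_cases i
      exacts [(isHomogeneous_X ℂ 1).neg, isHomogeneous_X ℂ 0]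
    have hp := IsHomogeneous.aeval (IsHomogeneous.map p.2 (starRingEnd ℂ)) _ hX
    rwa [one_mul] at hp⟩
  map_add' p q := Subtype.ext (by simp)
  map_smul' c p := Subtype.ext (by simp [smul_eq_C_mul])

lemma eval_twist {n : ℕ} (p : P n) (v : Fin 2 → ℂ) :
    eval v (twist n p : MvPolynomial (Fin 2) ℂ) = starRingEnd ℂ
      (eval ![-starRingEnd ℂ (v 1), starRingEnd ℂ (v 0)] (p : MvPolynomial (Fin 2) ℂ)) := by
  change eval v (aeval ![-X 1, X 0] (map (starRingEnd ℂ) p.1)) = _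
  induction p.1 using MvPolynomial.induction_on with
  | C a => simp only [map_C, aeval_C, algebraMap_eq, eval_C]
  | add f g hf hg => rw [map_add, map_add, map_add, map_add, map_add, hf, hg]
  | mul_X f i hf =>
    rw [map_mul, map_mul, map_mul, map_mul, map_mul, hf, map_X, aeval_X, eval_X]
    fin_cases i <;> simp

lemma twist_linPow (b : Fin 2 → ℂ) (n : ℕ) : twist n (linPow b n) =
    linPow ![starRingEnd ℂ (b 1), -starRingEnd ℂ (b 0)] n := by
  refine Subtype.ext (MvPolynomial.funext fun v => ?_)
  rw [eval_twist, eval_linPow, eval_linPow, map_pow]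
  simp [dotProduct, add_comm]

lemma inner_twist_twist {n : ℕ} (p q : P n) : inner ℂ (twist n p) (twist n q) = inner ℂ q p := by
  have h (a) : inner ℂ (twist n (linPow a n)) (twist n q) = inner ℂ q (linPow a n) := by
    rw [← inner_conj_symm q, twist_linPow, inner_linPow, inner_linPow, eval_twist, map_mul,
      map_natCast]
    congr 4
    ext i
    fin_cases i <;> simp
  have hext := LinearMap.ext_on_range (f := ((innerₛₗ ℂ).flip (twist n q)).comp (twist n))
    (g := innerₛₗ ℂ q) (span_range_linPow n) h
  exact LinearMap.congr_fun hext p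

lemma inner_linPow_tmul_alpha_linPow {m n h r p q : ℕ} (hm : m = h + p) (hn : n = h + q)
    (hpq : r = p + q) (hh : h ≤ min m n) (hr : r = m + n - 2 * h) (a b d : Fin 2 → ℂ) :
    inner ℂ (linPow a m ⊗ₜ[ℂ] linPow b n) (alpha m n h r hh hr (linPow d r)) =
      √(cgCoeff m n h) * (m ! * r.descFactorial q * n ! : ℕ) *
        (star (a 0 * b 1 - b 0 * a 1) ^ h * (d ⬝ᵥ star b) ^ q * (d ⬝ᵥ star a) ^ p) := by
  rw [inner_linPow_tmul, eval_alpha_linPow hm hn hpq, star_sub, star_mul', star_mul']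
  push_cast
  simp only [dotProduct, Pi.star_apply, starRingEnd_apply]
  ring

lemma factorial_mul_descFactorial_swap (p q q' : ℕ) :
    (q' + p)! * (q + p).descFactorial q = (q + p)! * (q' + p).descFactorial q' := by
  rw [← Nat.factorial_mul_descFactorial (Nat.le_add_right q p),
    ← Nat.factorial_mul_descFactorial (Nat.le_add_right q' p), Nat.add_sub_cancel_left,
    Nat.add_sub_cancel_left]
  ring

/-- The phase and the norm ratio between the Kraus operators of `Φ_{m,n,h}^*` and those of
`Φ_{r,n,h'}`, where `h + h' = n`. -/
def krausRatio (m r h' : ℕ) : ℂ := (-1) ^ h' * √((r + 1 : ℝ) / (m + 1))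

lemma krausRatio_mul_conj (m r h' : ℕ) :
    krausRatio m r h' * starRingEnd ℂ (krausRatio m r h') = ((r : ℂ) + 1) / (m + 1) := by
  rw [Complex.mul_conj, krausRatio, Complex.normSq_mul, Complex.normSq_ofReal,
    Real.mul_self_sqrt (by positivity)]
  simp

lemma inner_alpha_linPow {m n h r h' : ℕ} (hn : h + h' = n) (hh : h ≤ min m n)
    (hr : r = m + n - 2 * h) (hh' : h' ≤ min r n) (hr' : m = r + n - 2 * h')
    (a b d : Fin 2 → ℂ) :
    inner ℂ (alpha m n h r hh hr (linPow d r)) (linPow a m ⊗ₜ[ℂ] linPow b n) =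
      krausRatio m r h' *
        inner ℂ (linPow d r ⊗ₜ[ℂ] twist n (linPow b n)) (alpha r n h' m hh' hr' (linPow a m)) := by
  obtain ⟨p, rfl⟩ := Nat.exists_eq_add_of_le (hh.trans (min_le_left _ _))
  subst hn
  obtain rfl : r = h' + p := by omega
  set β : Fin 2 → ℂ := ![starRingEnd ℂ (b 1), -starRingEnd ℂ (b 0)] with hβ
  have hβa : a ⬝ᵥ star β = a 0 * b 1 - b 0 * a 1 := by
    simp only [β, dotProduct, Pi.star_apply, RCLike.star_def, Fin.sum_univ_two,
      Matrix.cons_val_zero, RingHomCompTriple.comp_apply, RingHom.id_apply, Matrix.cons_val_one,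
      Matrix.cons_val_fin_one, map_neg, mul_neg]
    ring
  have hβd : star (d 0 * β 1 - β 0 * d 1) = -(b ⬝ᵥ star d) := by
    simp only [β, dotProduct, Matrix.cons_val_one, Matrix.cons_val_fin_one, mul_neg,
      Matrix.cons_val_zero, star_sub, star_neg, star_mul', RCLike.star_def,
      RingHomCompTriple.comp_apply, RingHom.id_apply, Pi.star_apply, Fin.sum_univ_two, neg_add_rev]
    ring
  have hsign : (-1) ^ h' * (-(b ⬝ᵥ star d)) ^ h' = (b ⬝ᵥ star d) ^ h' := by
    rw [← mul_pow, neg_one_mul, neg_neg]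
  have hN := factorial_mul_descFactorial_swap p h' h
  refine (inner_conj_symm (𝕜 := ℂ) (E := P (h + p) ⊗[ℂ] P (h + h')) _ _).symm.trans ?_
  rw [inner_linPow_tmul_alpha_linPow rfl rfl (add_comm h' p), twist_linPow, ← hβ,
    inner_linPow_tmul_alpha_linPow rfl (add_comm h h') (add_comm h p), hN, cgCoeff_swap,
    Real.sqrt_mul (by positivity), krausRatio, hβa, hβd]
  simp only [map_mul, map_pow, map_natCast, Complex.conj_ofReal]
  simp only [starRingEnd_apply, star_star, ← Matrix.dotProduct_star, add_comm h' h, ← hsign]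
  push_cast
  ring

lemma adjoint_contract_alpha {m n h r h' : ℕ} (hn : h + h' = n) (hh : h ≤ min m n)
    (hr : r = m + n - 2 * h) (hh' : h' ≤ min r n) (hr' : m = r + n - 2 * h') (u : P n) :
    LinearMap.adjoint (contract (alpha m n h r hh hr) u) =
      krausRatio m r h' • contract (alpha r n h' m hh' hr') (twist n u) := by
  have hext : (TensorProduct.mk ℂ (P m) (P n)).flip.compr₂
      (LinearMap.adjoint (alpha m n h r hh hr)) =
        krausRatio m r h' • (contract (alpha r n h' m hh' hr')).comp (twist n) := by
    refine LinearMap.ext_on_range (span_range_linPow n) fun b => ?_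
    refine LinearMap.ext_on_range (span_range_linPow m) fun a => ext_inner_linPow fun d => ?_
    rw [LinearMap.smul_apply, LinearMap.smul_apply, inner_smul_right, LinearMap.comp_apply,
      inner_contract_apply, ← inner_alpha_linPow hn hh hr, ← LinearMap.adjoint_inner_right]
    rfl
  refine LinearMap.ext fun g => ?_
  rw [adjoint_contract_apply]
  exact LinearMap.congr_fun (LinearMap.congr_fun hext u) g

lemma exists_orthonormalBasis_coe_eq {K ι : Type*} [NormedAddCommGroup K] [InnerProductSpace ℂ K]
    [Fintype ι] (b : OrthonormalBasis ι ℂ K) {J : K →ₗ⋆[ℂ] K}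
    (hJ : ∀ x y, inner ℂ (J x) (J y) = inner ℂ y x) :
    ∃ b' : OrthonormalBasis ι ℂ K, ∀ t, b' t = J (b t) := by
  classical
  have := b.toBasis.finiteDimensional_of_finite
  have hJb : Orthonormal ℂ (J ∘ b) := orthonormal_iff_ite.2 fun s t => by
    simp only [Function.comp_apply, hJ, b.inner_eq_ite, eq_comm]
  have hspan := hJb.linearIndependent.span_eq_top_of_card_eq_finrank'
    (Module.finrank_eq_card_basis b.toBasis).symm
  exact ⟨OrthonormalBasis.mk hJb hspan.ge, fun t => by
    rw [OrthonormalBasis.coe_mk, Function.comp_apply]⟩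

lemma Phi_eq_krausMap {m n h r : ℕ} {ι : Type*} [Fintype ι] (b : OrthonormalBasis ι ℂ (P n))
    (hh : h ≤ min m n) (hr : r = m + n - 2 * h) :
    Phi m n h r hh hr = krausMap fun t => contract (alpha m n h r hh hr) (b t) :=
  LinearMap.ext fun A => by rw [Phi_apply, partialTrace_conj b]

theorem dualMap_Phi (m n h r h' : ℕ) (hn : h + h' = n) (hh : h ≤ min m n)
    (hr : r = m + n - 2 * h) (hh' : h' ≤ min r n) (hr' : m = r + n - 2 * h') :
    dualMap (Phi m n h r hh hr) = (((r : ℂ) + 1) / ((m : ℂ) + 1)) • Phi r n h' m hh' hr' := by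
  obtain ⟨b', hb'⟩ := exists_orthonormalBasis_coe_eq (stdOrthonormalBasis ℂ (P n)) inner_twist_twist
  simp only [Phi_eq_krausMap (stdOrthonormalBasis ℂ (P n)) hh, Phi_eq_krausMap b' hh',
    dualMap_krausMap, adjoint_contract_alpha hn hh hr hh' hr', hb', krausMap_smul,
    krausRatio_mul_conj]

lemma isCompletelyPositive_Phi (m n h r : ℕ) (hh : h ≤ min m n) (hr : r = m + n - 2 * h) :
    IsCompletelyPositive (Phi m n h r hh hr) := by
  rw [Phi_eq_krausMap (stdOrthonormalBasis ℂ (P n))]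
  exact isCompletelyPositive_krausMap _

lemma trace_Phi (m n h r : ℕ) (hh : h ≤ min m n) (hr : r = m + n - 2 * h) (A : P r →ₗ[ℂ] P r) :
    LinearMap.trace ℂ (P m) (Phi m n h r hh hr A) = LinearMap.trace ℂ (P r) A := by
  rw [Phi_apply, trace_partialTrace, LinearMap.trace_comp_comm', LinearMap.comp_assoc,
    adjoint_alpha_comp_alpha, LinearMap.comp_id]

instance (m : ℕ) : Nontrivial (P m) :=
  nontrivial_of_ne (linPow 1 m) 0 fun h => by
    have heval : (0 : ℂ) = 2 ^ m := by simpa [h, dotProduct] using eval_linPow 1 1 m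
    exact pow_ne_zero m two_ne_zero heval.symm

lemma isChannel_dualMap_Phi_iff (m n h r : ℕ) (hh : h ≤ min m n) (hr : r = m + n - 2 * h) :
    IsChannel (dualMap (Phi m n h r hh hr)) ↔ n = 2 * h := by
  rw [dualMap_Phi m n h r (n - h) (by omega) hh hr (by omega) (by omega)]
  constructor
  · rintro ⟨-, htr⟩
    have hdim : (Module.finrank ℂ (P m) : ℂ) ≠ 0 := Nat.cast_ne_zero.2 Module.finrank_pos.ne'
    have hratio : ((r : ℂ) + 1) / (m + 1) = 1 := by
      have hid := htr LinearMap.id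
      rw [LinearMap.smul_apply, map_smul, trace_Phi, LinearMap.trace_id, smul_eq_mul] at hid
      exact (mul_eq_right₀ hdim).1 hid
    rw [div_eq_one_iff_eq (Nat.cast_add_one_ne_zero m)] at hratio
    have hrm : r = m := by exact_mod_cast add_right_cancel hratio
    omega
  · intro hn
    obtain rfl : r = m := by omega
    rw [div_self (Nat.cast_add_one_ne_zero r), one_smul]
    exact ⟨isCompletelyPositive_Phi _ _ _ _ _ _, trace_Phi _ _ _ _ _ _⟩

end

end Eposic

theorem corollary5p6 (m n h r : ℕ) (hh : h ≤ min m n) (hr : r = m + n - 2 * h) :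
    Eposic.dualMap (Eposic.Phi m n h r hh hr) =
        (((r : ℂ) + 1) / ((m : ℂ) + 1)) •
          Eposic.Phi r n (n - h) m (by omega) (by omega) ∧
      (Eposic.IsChannel (Eposic.dualMap (Eposic.Phi m n h r hh hr)) ↔ n = 2 * h) ∧
      (∀ hn : n = 2 * h,
        Eposic.dualMap (Eposic.Phi m n h m hh (by omega)) =
          Eposic.Phi m (2 * h) h m (by omega) (by omega)) := by
  refine ⟨Eposic.dualMap_Phi m n h r (n - h) (by omega) hh hr _ _,
    Eposic.isChannel_dualMap_Phi_iff m n h r hh hr, ?_⟩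
  rintro rfl
  rw [Eposic.dualMap_Phi m (2 * h) h m h (by omega) hh (by omega) hh (by omega),
    div_self (Nat.cast_add_one_ne_zero m), one_smul]
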